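/- The distinguishing game with $d\ge 1$ colors on a finite simple graph $H$ is played by two players, Gentle and Rascal, who alternately choose an uncolored vertex of $H$ and color it with one of the $d$ colors, until all vertices are colored. Gentle wins if the identity is the only automorphism of $H$ that preserves the resulting coloring; otherwise Rascal wins. Let $D_{\mathcal R}(H)$ be the least $d\ge 1$ such that Gentle has a winning strategy when Rascal plays first ($D_{\mathcal R}(H)=\infty$ if there is no such $d$). Let $C_k$ be the cycle of order $k$ and $\square$ the Cartesian product of graphs. Let $n$ and $m$ be two distinct natural numbers greater than or equal to $3$. If $n$ is even and $n\ge 8$, then $D_{\mathcal R}(C_n\square C_m)=2$. -/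

import Mathlib

/-! The distinguishing game on a nonempty finite simple graph `G`, with colors `Fin d`. -/

namespace DistinguishingGame

/-- A coloring is distinguishing if only the trivial automorphism of the graph preserves it. -/
def IsDistinguishing {V : Type*} (G : SimpleGraph V) {d : ℕ} (c : V → Fin d) : Prop :=
  ∀ σ : G ≃g G, (∀ v, c (σ v) = c v) → ∀ v, σ v = v

inductive Player
  | gentle
  | rascal

/-- The moves made so far, the most recent one first; the move `(v, k)` colors the vertex `v`
with the color `k`. -/
abbrev History (V : Type*) (d : ℕ) := List (V × Fin d)

/-- The vertex `v` has already been colored. -/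
def History.Colored {V : Type*} {d : ℕ} (h : History V d) (v : V) : Prop :=
  ∃ k : Fin d, (v, k) ∈ h

/-- All the vertices have been colored: the game is over. -/
def History.Complete {V : Type*} {d : ℕ} (h : History V d) : Prop :=
  ∀ v, h.Colored v

/-- A strategy of Gentle: the move he makes, given the moves made so far. -/
abbrev Strategy (V : Type*) (d : ℕ) := History V d → V × Fin d

/-- `Reachable first s h p`: when the player `first` starts and Gentle plays according to `s`, a
legal sequence of moves can lead to the history `h`, with the player `p` next in turn. Rascal
may give any color to any uncolored vertex. -/
inductive Reachable {V : Type*} {d : ℕ} (first : Player) (s : Strategy V d) :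
    History V d → Player → Prop
  | start : Reachable first s [] first
  | rascal_move {h : History V d} (v : V) (k : Fin d) :
      Reachable first s h .rascal → ¬ h.Colored v → Reachable first s ((v, k) :: h) .gentle
  | gentle_move {h : History V d} :
      Reachable first s h .gentle → ¬ h.Colored (s h).1 → Reachable first s (s h :: h) .rascal

/-- `s` is a winning strategy of Gentle: it always provides a legal move when Gentle has to play,
and every play that follows it ends with a distinguishing coloring. -/
structure Strategy.IsWinning {V : Type*} {d : ℕ} (s : Strategy V d) (G : SimpleGraph V)
    (first : Player) : Prop where
  legal : ∀ h, Reachable first s h .gentle → ¬ h.Complete → ¬ h.Colored (s h).1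
  wins : ∀ h p, Reachable first s h p → h.Complete →
    ∃ c : V → Fin d, (∀ v k, (v, k) ∈ h → c v = k) ∧ IsDistinguishing G c

/-- Gentle has a winning strategy in the game on `G` with `d` colors, when `first` starts. -/
def GentleWins {V : Type*} (G : SimpleGraph V) (first : Player) (d : ℕ) : Prop :=
  ∃ s : Strategy V d, s.IsWinning G first

/-- The game distinguishing number, when `first` starts: the least positive number of colors with
which Gentle has a winning strategy, and `⊤` if there is none. -/
noncomputable def gameDistinguishingNumber {V : Type*} (G : SimpleGraph V) (first : Player) : ℕ∞ :=
  ⨅ (d : ℕ) (_ : 1 ≤ d ∧ GentleWins G first d), (d : ℕ∞)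

/-- The R-game distinguishing number: Rascal plays first. -/
noncomputable def DR {V : Type*} (G : SimpleGraph V) : ℕ∞ :=
  gameDistinguishingNumber G .rascal

end DistinguishingGame

/-! The number of vertices is even and Rascal starts, so Gentle can follow a pairing strategy: he
pairs each vertex `(i, j)` with its antipode `(i + n / 2, j)` and answers every move in the same
pair, which lets him decide, pair by pair, whether the two colors will agree
(`DistinguishingGame.exists_isWinning_of_pairing`). He makes them differ on exactly three pairs,
those of `(0, 0)`, `(0, 1)` and `(1, 0)`.

Because `n ≠ m` and `n ≥ 5`, every automorphism of `C_n □ C_m` is a product of a symmetry `α` of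
`C_n` and a symmetry `β` of `C_m` (`Torus.IsAut.exists_eq_prod`). The reason is that `v - (1, 0)`
and `v + (1, 0)` have no common neighbor but `v`, whereas for different unit steps `d` and `d'` the
vertices `v - d` and `v + d'` have the further common neighbor `v - d + d'`. So an automorphism maps
horizontal lines to straight lines, and these are horizontal since vertical ones have `m ≠ n`
vertices.

Such a product commutes with the antipodal map, so if it preserves the final coloring, it permutes
the three special pairs. The L-shape that they form in the quotient has no symmetry in a product of
dihedral groups; hence the automorphism is the identity or the antipodal map, and the latter changes
the color of `(0, 0)`.

With a single color the final coloring is constant, and it is preserved by a rotation. -/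

/-! ### Pairing strategies -/

namespace DistinguishingGame

section Pairing

variable {V : Type*} {d : ℕ}

lemma History.colored_cons {h : History V d} {v w : V} {k : Fin d} :
    History.Colored ((v, k) :: h) w ↔ w = v ∨ h.Colored w := by
  simp only [History.Colored, List.mem_cons, Prod.mk.injEq]
  constructor
  · rintro ⟨l, ⟨rfl, -⟩ | hl⟩
    exacts [Or.inl rfl, Or.inr ⟨l, hl⟩]
  · rintro (rfl | ⟨l, hl⟩)
    exacts [⟨k, Or.inl ⟨rfl, rfl⟩⟩, ⟨l, Or.inr hl⟩]

/-- The history is consistent with the pairing `τ` and the answers `f`: no vertex has two colors,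
and the partner `τ v` of each vertex `v` of color `k` has the color `f v k`. -/
def History.Paired (τ : V → V) (f : V → Fin d → Fin d) (h : History V d) : Prop :=
  (∀ v k l, (v, k) ∈ h → (v, l) ∈ h → k = l) ∧ ∀ v k, (v, k) ∈ h → (τ v, f v k) ∈ h

lemma History.Paired.nil {τ : V → V} {f : V → Fin d → Fin d} :
    History.Paired τ f ([] : History V d) := by
  simp [History.Paired]

lemma History.Paired.colored {τ : V → V} {f : V → Fin d → Fin d} {h : History V d}
    (hp : h.Paired τ f) {v : V} (hv : h.Colored v) : h.Colored (τ v) :=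
  let ⟨k, hk⟩ := hv
  ⟨f v k, hp.2 v k hk⟩

lemma History.Paired.not_colored_cons {τ : V → V} {f : V → Fin d → Fin d} {h : History V d}
    (hττ : ∀ v, τ (τ v) = v) (hτ : ∀ v, τ v ≠ v) (hp : h.Paired τ f) {v : V} (k : Fin d)
    (hv : ¬ h.Colored v) : ¬ History.Colored ((v, k) :: h) (τ v) := by
  rw [History.colored_cons]
  rintro (h1 | h1)
  · exact hτ v h1
  · exact hv (hττ v ▸ hp.colored h1)

lemma History.Paired.cons_cons {τ : V → V} {f : V → Fin d → Fin d} {h : History V d}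
    (hττ : ∀ v, τ (τ v) = v) (hτ : ∀ v, τ v ≠ v) (hf : ∀ v k, f (τ v) (f v k) = k)
    (hp : h.Paired τ f) {v : V} (k : Fin d) (hv : ¬ h.Colored v) :
    History.Paired τ f ((τ v, f v k) :: (v, k) :: h) := by
  have hv' := hp.not_colored_cons hττ hτ k hv
  rw [History.colored_cons, not_or] at hv'
  have hne := hτ v
  constructor
  · intro w l l' h1 h2
    simp only [List.mem_cons, Prod.mk.injEq] at h1 h2
    rcases h1 with ⟨h1, rfl⟩ | ⟨h1, rfl⟩ | h1 <;> rcases h2 with ⟨h2, rfl⟩ | ⟨h2, rfl⟩ | h2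
    · rfl
    · exact absurd (h1.symm.trans h2) hne
    · exact absurd ⟨_, h1 ▸ h2⟩ hv'.2
    · exact absurd (h2.symm.trans h1) hne
    · rfl
    · exact absurd ⟨_, h1 ▸ h2⟩ hv
    · exact absurd ⟨_, h2 ▸ h1⟩ hv'.2
    · exact absurd ⟨_, h2 ▸ h1⟩ hv
    · exact hp.1 w l l' h1 h2
  · intro w l h1
    simp only [List.mem_cons, Prod.mk.injEq] at h1 ⊢
    rcases h1 with ⟨rfl, rfl⟩ | ⟨rfl, rfl⟩ | h1
    · exact Or.inr (Or.inl ⟨hττ v, hf v k⟩)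
    · exact Or.inl ⟨rfl, rfl⟩
    · exact Or.inr (Or.inr (hp.2 w l h1))

/-- If `τ` is a fixed-point free involution and the answers `f` are compatible with it, then Gentle,
playing second, can force the final coloring `c` to satisfy `c (τ v) = f v (c v)` for all `v`. -/
theorem exists_isWinning_of_pairing [Nonempty V] (G : SimpleGraph V) (τ : V → V)
    (f : V → Fin d → Fin d) (hττ : ∀ v, τ (τ v) = v) (hτ : ∀ v, τ v ≠ v)
    (hf : ∀ v k, f (τ v) (f v k) = k) (hd : 0 < d)
    (hG : ∀ c : V → Fin d, (∀ v, c (τ v) = f v (c v)) → IsDistinguishing G c) :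
    GentleWins G .rascal d := by
  let s : Strategy V d := fun h ↦ match h with
    | [] => (Classical.arbitrary V, ⟨0, hd⟩)
    | (v, k) :: _ => (τ v, f v k)
  -- When Gentle is next, the history minus the last move of Rascal is consistent with the pairing.
  have key : ∀ h p, Reachable .rascal s h p →
      match p with
      | .rascal => h.Paired τ f
      | .gentle => ∃ v k h', h = (v, k) :: h' ∧ History.Paired τ f h' ∧
          ¬ History.Colored h' v := by
    intro h p hr
    induction hr with
    | start => exact History.Paired.nil
    | rascal_move v k _ hv ih => exact ⟨v, k, _, rfl, ih, hv⟩
    | gentle_move _ _ ih =>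
      obtain ⟨v, k, h', rfl, hp, hv⟩ := ih
      exact hp.cons_cons hττ hτ hf k hv
  refine ⟨s, fun h hr _ ↦ ?_, fun h p hr hc ↦ ?_⟩
  · obtain ⟨v, k, h', rfl, hp, hv⟩ := key h _ hr
    exact hp.not_colored_cons hττ hτ k hv
  · cases p with
    | gentle =>
      obtain ⟨v, k, h', rfl, hp, hv⟩ := key h _ hr
      exact absurd (hc (τ v)) (hp.not_colored_cons hττ hτ k hv)
    | rascal =>
      have hp : h.Paired τ f := key h _ hr
      choose c hcol using hc
      refine ⟨c, fun v k hk ↦ hp.1 v _ _ (hcol v) hk, hG c fun v ↦ ?_⟩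
      exact hp.1 _ _ _ (hcol (τ v)) (hp.2 v _ (hcol v))

end Pairing

/-! ### A single color -/

/-- On a finite graph, every play in which Gentle follows a winning strategy can be continued
until all vertices are colored. -/
lemma Strategy.IsWinning.exists_complete {V : Type*} [Finite V] {d : ℕ} (hd : 0 < d)
    {G : SimpleGraph V} {first : Player} {s : Strategy V d} (hs : s.IsWinning G first) :
    ∃ h p, Reachable first s h p ∧ h.Complete := by
  suffices H : ∀ (N : ℕ) (h : History V d) (p : Player), Reachable first s h p →
      {v | ¬ h.Colored v}.ncard = N → ∃ h p, Reachable first s h p ∧ h.Complete from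
    H _ [] first .start rfl
  intro N
  induction N using Nat.strong_induction_on with
  | _ N ih =>
    intro h p hr hN
    by_cases hc : h.Complete
    · exact ⟨h, p, hr, hc⟩
    have step : ∀ v k, ¬ h.Colored v →
        {w | ¬ History.Colored ((v, k) :: h) w}.ncard < N := fun v k hv ↦ by
      rw [← hN]
      refine Set.ncard_lt_ncard ⟨fun w hw hw' ↦ hw (History.colored_cons.2 (.inr hw')),
        fun hsub ↦ hsub hv (History.colored_cons.2 (.inl rfl))⟩
    cases p with
    | gentle =>
      have hl := hs.legal h hr hc
      exact ih _ (step _ (s h).2 hl) _ _ (.gentle_move hr hl) rfl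
    | rascal =>
      obtain ⟨v, hv⟩ := not_forall.1 hc
      exact ih _ (step v ⟨0, hd⟩ hv) _ _ (.rascal_move v ⟨0, hd⟩ hr hv) rfl

lemma not_gentleWins_one {V : Type*} [Finite V] {G : SimpleGraph V} {first : Player}
    (σ : G ≃g G) {v : V} (hv : σ v ≠ v) : ¬ GentleWins G first 1 := by
  rintro ⟨s, hs⟩
  obtain ⟨h, p, hr, hc⟩ := hs.exists_complete one_pos
  obtain ⟨c, -, hc⟩ := hs.wins h p hr hc
  exact hv (hc σ (fun _ ↦ Subsingleton.elim _ _) v)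

lemma DR_eq_two {V : Type*} {G : SimpleGraph V} (h1 : ¬ GentleWins G .rascal 1)
    (h2 : GentleWins G .rascal 2) : DR G = 2 := by
  refine le_antisymm (iInf₂_le 2 ⟨one_le_two, h2⟩) (le_iInf₂ fun d hd ↦ ?_)
  have : d ≠ 1 := by rintro rfl; exact h1 hd.2
  exact_mod_cast (show 2 ≤ d by have := hd.1; omega)

end DistinguishingGame

/-! ### Automorphisms of the discrete torus -/

namespace Torus

variable {n m : ℕ}

/-- The differences of adjacent vertices of `C_n □ C_m`, with vertices in `ZMod n × ZMod m`. -/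
def steps (n m : ℕ) : Set (ZMod n × ZMod m) := {(1, 0), (-1, 0), (0, 1), (0, -1)}

lemma neg_mem_steps {d : ZMod n × ZMod m} (hd : d ∈ steps n m) : -d ∈ steps n m := by
  simp only [steps, Set.mem_insert_iff, Set.mem_singleton_iff] at hd ⊢
  rcases hd with rfl | rfl | rfl | rfl <;> simp

/-- A permutation of the vertices is an automorphism of the torus. -/
def IsAut (g : Equiv.Perm (ZMod n × ZMod m)) : Prop :=
  ∀ v w, g w - g v ∈ steps n m ↔ w - v ∈ steps n m

lemma IsAut.symm {g : Equiv.Perm (ZMod n × ZMod m)} (hg : IsAut g) : IsAut g.symm := fun v w ↦ by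
  simpa using (hg (g.symm v) (g.symm w)).symm

/-- A small natural number does not vanish in `ZMod n`. -/
lemma natCast_ne_zero_of_lt {k : ℕ} (hk : 0 < k) (hkn : k < n) : (k : ZMod n) ≠ 0 := fun h ↦
  absurd (Nat.le_of_dvd hk ((ZMod.natCast_eq_zero_iff k n).1 h)) (by omega)

/-- The vertices `v - (1, 0)` and `v + (1, 0)` have the only common neighbor `v`. -/
lemma eq_of_common_neighbor (hn : 5 ≤ n) (hm : 2 ≤ m) {v x : ZMod n × ZMod m}
    (h1 : x - (v - (1, 0)) ∈ steps n m) (h2 : x - (v + (1, 0)) ∈ steps n m) : x = v := by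
  have n1 : ((1 : ℕ) : ZMod n) ≠ 0 := natCast_ne_zero_of_lt (by omega) (by omega)
  have n2 : ((2 : ℕ) : ZMod n) ≠ 0 := natCast_ne_zero_of_lt (by omega) (by omega)
  have n4 : ((4 : ℕ) : ZMod n) ≠ 0 := natCast_ne_zero_of_lt (by omega) (by omega)
  have m1 : ((1 : ℕ) : ZMod m) ≠ 0 := natCast_ne_zero_of_lt (by omega) (by omega)
  obtain ⟨a, b⟩ := v
  obtain ⟨x, y⟩ := x
  simp only [steps, Set.mem_insert_iff, Set.mem_singleton_iff, Prod.mk_sub_mk, Prod.mk_add_mk,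
    Prod.mk.injEq] at *
  push_cast at n1 n2 n4 m1
  grind

/-- Two consecutive edges of a horizontal line are mapped to two edges with the same direction. -/
lemma IsAut.sub_eq_sub {g : Equiv.Perm (ZMod n × ZMod m)} (hg : IsAut g) (hn : 5 ≤ n) (hm : 2 ≤ m)
    (v : ZMod n × ZMod m) : g (v + (1, 0)) - g v = g v - g (v - (1, 0)) := by
  have hd : g (v + (1, 0)) - g v ∈ steps n m := by rw [hg]; simp [steps]
  have hd' : g v - g (v - (1, 0)) ∈ steps n m := by rw [hg]; simp [steps]
  -- The fourth vertex of the parallelogram is a common neighbor of the two images.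
  obtain ⟨x, hx⟩ := g.surjective (g (v - (1, 0)) + (g (v + (1, 0)) - g v))
  have h1 : x - (v - (1, 0)) ∈ steps n m := by
    rw [← hg, hx]; simpa using hd
  have h2 : x - (v + (1, 0)) ∈ steps n m := by
    rw [← hg, hx]
    convert neg_mem_steps hd' using 1
    abel
  rw [eq_of_common_neighbor hn hm h1 h2] at hx
  nth_rw 2 [hx]
  abel

lemma IsAut.map_add_nsmul {g : Equiv.Perm (ZMod n × ZMod m)} (hg : IsAut g) (hn : 5 ≤ n)
    (hm : 2 ≤ m) (v : ZMod n × ZMod m) (k : ℕ) :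
    g (v + k • (1, 0)) = g v + k • (g (v + (1, 0)) - g v) := by
  have diff : ∀ k : ℕ, g (v + (k + 1) • (1, 0)) - g (v + k • (1, 0)) = g (v + (1, 0)) - g v := by
    intro k
    induction k with
    | zero => simp
    | succ k ih =>
      have := hg.sub_eq_sub hn hm (v + (k + 1) • (1, 0))
      rw [← ih, show v + (k + 1 + 1) • ((1, 0) : ZMod n × ZMod m) =
        v + (k + 1) • (1, 0) + (1, 0) by rw [succ_nsmul _ (k + 1)]; abel, this]
      congr 2
      rw [succ_nsmul]; abel
  induction k with
  | zero => simp
  | succ k ih =>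
    rw [succ_nsmul (g (v + (1, 0)) - g v), ← add_assoc, ← ih, ← diff k]; abel

/-- An automorphism maps horizontal edges to horizontal edges. -/
lemma IsAut.horizontal {g : Equiv.Perm (ZMod n × ZMod m)} (hg : IsAut g) (hn : 5 ≤ n)
    (hm : 2 ≤ m) (hmn : m ≠ n) (v : ZMod n × ZMod m) :
    g (v + (1, 0)) - g v = (1, 0) ∨ g (v + (1, 0)) - g v = (-1, 0) := by
  have hd : g (v + (1, 0)) - g v ∈ steps n m := by rw [hg]; simp [steps]
  have hk := hg.map_add_nsmul hn hm v
  -- A vertical direction would give a line with both `n` and `m` vertices.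
  have aux : ∀ y : ZMod m, (∀ k : ℕ, k • y = 0 ↔ m ∣ k) →
      g (v + (1, 0)) - g v ≠ (0, y) := fun y hy h ↦ by
    rw [h] at hk
    have hdvd : ∀ k : ℕ, n ∣ k ↔ m ∣ k := fun k ↦ by
      rw [← hy k]
      have h1 := hk k
      constructor
      · intro hnk
        have h0 : (k : ZMod n) = 0 := (ZMod.natCast_eq_zero_iff _ _).2 hnk
        rw [show v + k • (1, 0) = v by simp [h0], left_eq_add] at h1
        exact congrArg Prod.snd h1
      · intro hyk
        have h2 : g (v + k • (1, 0)) = g v := by rw [h1, Prod.smul_mk, hyk]; simp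
        have h3 := congrArg Prod.fst (add_eq_left.1 (g.injective h2))
        exact (ZMod.natCast_eq_zero_iff _ _).1 (by simpa using h3)
    exact hmn (Nat.dvd_antisymm ((hdvd n).1 dvd_rfl) ((hdvd m).2 dvd_rfl))
  rcases hd with h | h | h | h
  · exact Or.inl h
  · exact Or.inr h
  · exact absurd h (aux 1 fun k ↦ by simp [ZMod.natCast_eq_zero_iff])
  · exact absurd h (aux (-1) fun k ↦ by simp [ZMod.natCast_eq_zero_iff])

/-- An automorphism maps vertical edges to vertical edges. -/
lemma IsAut.vertical {g : Equiv.Perm (ZMod n × ZMod m)} (hg : IsAut g) (hn : 5 ≤ n)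
    (hm : 2 ≤ m) (hmn : m ≠ n) (v : ZMod n × ZMod m) :
    g (v + (0, 1)) - g v = (0, 1) ∨ g (v + (0, 1)) - g v = (0, -1) := by
  have hd : g (v + (0, 1)) - g v ∈ steps n m := by rw [hg]; simp [steps]
  have m1 : (1 : ZMod m) ≠ 0 := by
    exact_mod_cast natCast_ne_zero_of_lt (n := m) (k := 1) (by omega) (by omega)
  rcases hd with h | h | h | h
  · -- The inverse of `g` maps horizontal edges to horizontal edges.
    have h1 := hg.symm.horizontal hn hm hmn (g v)
    rw [show g v + (1, 0) = g (v + (0, 1)) by rw [← h]; abel] at h1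
    simp [m1] at h1
  · have h1 := hg.symm.horizontal hn hm hmn (g (v + (0, 1)))
    rw [show g (v + (0, 1)) + (1, 0) = g v by
      rw [show ((1, 0) : ZMod n × ZMod m) = -(-1, 0) by simp, ← h]; abel] at h1
    simp [m1] at h1
  · exact Or.inl h
  · exact Or.inr h

/-- An automorphism is a product of a symmetry of `C_n`, of the form `i ↦ x + s * i` with
`s = 1` or `s = -1`, and an injective map `β` with unit steps on `C_m`. -/
theorem IsAut.exists_eq_prod [NeZero n] [NeZero m] {g : Equiv.Perm (ZMod n × ZMod m)}
    (hg : IsAut g) (hn : 5 ≤ n) (hm : 2 ≤ m) (hmn : m ≠ n) :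
    ∃ (x s : ZMod n) (β : ZMod m → ZMod m), (s = 1 ∨ s = -1) ∧ Function.Injective β ∧
      (∀ j, β (j + 1) - β j = 1 ∨ β (j + 1) - β j = -1) ∧
      ∀ i j, g (i, j) = (x + s * i, β j) := by
  have fst_eq : ∀ i j, (g (i, j)).1 = (g (i, 0)).1 := fun i j ↦ by
    rw [← ZMod.natCast_zmod_val j]
    generalize j.val = k
    induction k with
    | zero => simp
    | succ k ih =>
      have h := hg.vertical hn hm hmn (i, (k : ZMod m))
      rw [← ih, ← sub_eq_zero, ← Prod.fst_sub]
      simp only [Prod.mk_add_mk, add_zero] at h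
      push_cast
      rcases h with h | h <;> rw [h]
  have hline : ∀ i j, g (i, j) = g (0, j) + i.val • (g (1, j) - g (0, j)) := fun i j ↦ by
    simpa using hg.map_add_nsmul hn hm (0, j) i.val
  have hdir : ∀ j, g (1, j) - g (0, j) = (1, 0) ∨ g (1, j) - g (0, j) = (-1, 0) := fun j ↦ by
    simpa using hg.horizontal hn hm hmn (0, j)
  have snd_eq : ∀ i j, (g (i, j)).2 = (g (0, j)).2 := fun i j ↦ by
    rw [hline]
    rcases hdir j with h | h <;> simp [h]
  refine ⟨(g (0, 0)).1, (g (1, 0)).1 - (g (0, 0)).1, fun j ↦ (g (0, j)).2, ?_, ?_, ?_, ?_⟩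
  · rw [← Prod.fst_sub]
    rcases hdir 0 with h | h <;> simp [h]
  · intro j j' h
    have : g (0, j) = g (0, j') := Prod.ext (by rw [fst_eq 0 j, fst_eq 0 j']) h
    exact congrArg Prod.snd (g.injective this)
  · intro j
    have h := hg.vertical hn hm hmn (0, j)
    rw [← Prod.snd_sub]
    simp only [Prod.mk_add_mk, add_zero] at h
    rcases h with h | h <;> simp [h]
  · intro i j
    refine Prod.ext ?_ (snd_eq i j)
    rw [fst_eq, hline]
    simp [mul_comm]

/-- An injective map with unit steps on a cycle that fixes `0` and `1` is the identity. -/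
lemma eq_self_of_injective [NeZero m] {β : ZMod m → ZMod m} (hm : 3 ≤ m)
    (hβ : Function.Injective β) (hstep : ∀ j, β (j + 1) - β j = 1 ∨ β (j + 1) - β j = -1)
    (h0 : β 0 = 0) (h1 : β 1 = 1) (j : ZMod m) : β j = j := by
  have m2 : ((2 : ℕ) : ZMod m) ≠ 0 := natCast_ne_zero_of_lt (by omega) (by omega)
  push_cast at m2
  suffices H : ∀ k : ℕ, β k = k ∧ β (k + 1) = k + 1 by
    simpa using (H j.val).1
  intro k
  induction k with
  | zero => simpa using ⟨h0, h1⟩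
  | succ k ih =>
    push_cast
    refine ⟨ih.2, ?_⟩
    rcases hstep (k + 1) with h | h
    · rw [ih.2] at h; linear_combination h
    · have : β (k + 1 + 1) = β k := by rw [ih.1]; rw [ih.2] at h; linear_combination h
      exact absurd (by linear_combination hβ this) m2

/-! ### The L-shaped set of special pairs -/

/-- The set of vertices whose color differs from that of the antipode: the vertices `(0, 0)`,
`(0, 1)`, `(1, 0)` and their antipodes, where `(i, j)` and `(i + a, j)` are antipodal. -/
def special (a : ZMod n) : Set (ZMod n × ZMod m) :=
  {p | (p.1 = 0 ∨ p.1 = a) ∧ (p.2 = 0 ∨ p.2 = 1) ∨ (p.1 = 1 ∨ p.1 = 1 + a) ∧ p.2 = 0}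

lemma add_mem_special {a : ZMod n} (ha : a + a = 0) (p : ZMod n × ZMod m) :
    p + (a, 0) ∈ special a ↔ p ∈ special a := by
  have h1 : p.1 + a = 0 ↔ p.1 = a := by grind
  have h2 : p.1 + a = 1 ↔ p.1 = 1 + a := by grind
  simp [special, h1, h2, or_comm]

/-- A coloring that differs from its antipodal coloring exactly on the special set is preserved
only by the trivial automorphism. -/
theorem IsAut.eq_self_of_special {C : Type*} {a : ℕ} (hna : n = 2 * a) (ha : 3 ≤ a) (hm : 3 ≤ m)
    (hmn : m ≠ n)
    {g : Equiv.Perm (ZMod n × ZMod m)} (hg : IsAut g) (c : ZMod n × ZMod m → C)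
    (hc : ∀ v, c (v + ((a : ZMod n), 0)) = c v ↔ v ∉ special (a : ZMod n))
    (hgc : ∀ v, c (g v) = c v) (v : ZMod n × ZMod m) : g v = v := by
  have : NeZero n := ⟨by omega⟩
  have : NeZero m := ⟨by omega⟩
  obtain ⟨x, s, β, hs, hβ, hstep, hgp⟩ := hg.exists_eq_prod (by omega) (by omega) hmn
  have n1 : ((1 : ℕ) : ZMod n) ≠ 0 := natCast_ne_zero_of_lt (by omega) (by omega)
  have n2 : ((2 : ℕ) : ZMod n) ≠ 0 := natCast_ne_zero_of_lt (by omega) (by omega)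
  have na : ((a + 1 : ℕ) : ZMod n) ≠ 0 := natCast_ne_zero_of_lt (by omega) (by omega)
  have na2 : ((a + 2 : ℕ) : ZMod n) ≠ 0 := natCast_ne_zero_of_lt (by omega) (by omega)
  have haa : (a : ZMod n) + a = 0 := by
    rw [← Nat.cast_add, ← two_mul, ← hna, ZMod.natCast_self]
  have m1 : ((1 : ℕ) : ZMod m) ≠ 0 := natCast_ne_zero_of_lt (by omega) (by omega)
  push_cast at n1 n2 na na2 m1
  generalize (a : ZMod n) = A at *
  have hsA : s * A = A := by
    rcases hs with rfl | rfl
    · ring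
    · linear_combination -haa
  -- The automorphism commutes with the antipodal map, so it preserves the special set.
  have hsp : ∀ i j, (x + s * i, β j) ∈ special (m := m) A ↔ (i, j) ∈ special (m := m) A := by
    intro i j
    rw [← not_iff_not, ← hc, ← hc, ← hgp, hgc, ← hgc ((i, j) + (A, 0))]
    have : g (i, j) + (A, 0) = g ((i, j) + (A, 0)) := by
      simp only [Prod.mk_add_mk, hgp, add_zero, mul_add, hsA, add_assoc]
    rw [this]
  have h00 := hsp 0 0
  have h01 := hsp 0 1
  have h10 := hsp 1 0
  have h11 := hsp 1 1
  have hβ01 : β 0 ≠ β 1 := fun h ↦ m1 (hβ h).symm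
  simp only [special, Set.mem_ofPred_eq, mul_zero, add_zero, mul_one] at h00 h01 h10 h11
  -- Only the column of `0` and its antipodal column hold two special vertices.
  have hx : x = 0 ∨ x = A := by grind
  have hx1 : x + s = 1 ∨ x + s = 1 + A := by grind
  have hβ0 : β 0 = 0 := by grind
  have hβ1 : β 1 = 1 := by grind
  have hs1 : s = 1 := by grind
  have hβid := eq_self_of_injective hm hβ hstep hβ0 hβ1
  subst hs1
  rcases hx with rfl | rfl
  · rw [← Prod.mk.eta (p := v), hgp, hβid]; simp
  · -- The antipodal map does not preserve the color of the special vertex `(0, 0)`.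
    have h := hgc (0, 0)
    rw [hgp, hβid] at h
    exact absurd (by simp [special]) ((hc (0, 0)).1 (by simpa using h))

end Torus

open DistinguishingGame Torus

/-! ### The product of two cycles -/

/-- `Fin (k + 2)`, the vertex type of the cycle, is `ZMod (k + 2)` by definition. -/
lemma boxProd_cycleGraph_adj {k l : ℕ} (v w : ZMod (k + 2) × ZMod (l + 2)) :
    ((SimpleGraph.cycleGraph (k + 2)).boxProd (SimpleGraph.cycleGraph (l + 2))).Adj v w ↔
      w - v ∈ steps (k + 2) (l + 2) := by
  obtain ⟨a, b⟩ := v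
  obtain ⟨a', b'⟩ := w
  refine (show _ ↔ (SimpleGraph.cycleGraph (k + 2)).Adj a a' ∧ b = b' ∨
    (SimpleGraph.cycleGraph (l + 2)).Adj b b' ∧ a = a' from SimpleGraph.boxProd_adj).trans ?_
  refine (or_congr (and_congr_left' SimpleGraph.cycleGraph_adj)
    (and_congr_left' SimpleGraph.cycleGraph_adj)).trans ?_
  change ((a - a' = 1 ∨ a' - a = 1) ∧ b = b' ∨ (b - b' = 1 ∨ b' - b = 1) ∧ a = a') ↔
    ((a' - a, b' - b) : ZMod (k + 2) × ZMod (l + 2)) ∈ steps (k + 2) (l + 2)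
  simp only [steps, Set.mem_insert_iff, Set.mem_singleton_iff, Prod.mk.injEq]
  grind

theorem proposition5p1 (n m : ℕ) (hn : Even n) (hn8 : 8 ≤ n) (hm : 3 ≤ m) (hmn : m ≠ n) :
    DistinguishingGame.DR
      (SimpleGraph.boxProd (SimpleGraph.cycleGraph n) (SimpleGraph.cycleGraph m)) = 2 := by
  obtain ⟨a, ha⟩ := hn
  obtain ⟨k, rfl⟩ : ∃ k, n = k + 2 := ⟨n - 2, by omega⟩
  obtain ⟨l, rfl⟩ : ∃ l, m = l + 2 := ⟨m - 2, by omega⟩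
  have hadj := boxProd_cycleGraph_adj (k := k) (l := l)
  have haa : (a : ZMod (k + 2)) + a = 0 := by
    rw [← Nat.cast_add, ← ha, ZMod.natCast_self]
  have ha0 : (a : ZMod (k + 2)) ≠ 0 := natCast_ne_zero_of_lt (by omega) (by omega)
  refine DR_eq_two ?_ ?_
  · let e : Equiv.Perm (ZMod (k + 2) × ZMod (l + 2)) := Equiv.addRight ((a : ZMod (k + 2)), 0)
    have he : IsAut e := fun v w ↦ by simp [e]
    refine not_gentleWins_one (v := (0 : ZMod (k + 2) × ZMod (l + 2)))
      ⟨e, fun {v w} ↦ ?_⟩ fun h ↦ ha0 ?_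
    · exact (hadj _ _).trans ((he v w).trans (hadj v w).symm)
    · have h' : e 0 = 0 := h
      simpa [e, Prod.ext_iff] using h'
  · classical
    let τ : ZMod (k + 2) × ZMod (l + 2) → ZMod (k + 2) × ZMod (l + 2) :=
      fun v ↦ v + ((a : ZMod (k + 2)), 0)
    let f : ZMod (k + 2) × ZMod (l + 2) → Fin 2 → Fin 2 :=
      fun v b ↦ if v ∈ special (a : ZMod (k + 2)) then b + 1 else b
    have hfix : ∀ b : Fin 2, b + 1 ≠ b := by decide
    have hinv : ∀ b : Fin 2, b + 1 + 1 = b := by decide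
    refine exists_isWinning_of_pairing (V := ZMod (k + 2) × ZMod (l + 2)) _ τ f
      (fun v ↦ ?_) (fun v h ↦ ha0 ?_) (fun v b ↦ ?_) two_pos fun c hc σ hσ ↦ ?_
    · simp [τ, add_assoc, haa]
    · simpa [τ, Prod.ext_iff] using h
    · by_cases hv : v ∈ special (a : ZMod (k + 2)) <;>
        simp [f, τ, add_mem_special haa, hv, hinv]
    · have hσ' : IsAut σ.toEquiv := fun v w ↦
        (hadj _ _).symm.trans (σ.map_rel_iff.trans (hadj v w))
      refine hσ'.eq_self_of_special (a := a) (by omega) (by omega) (by omega) (by omega) c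
        (fun v ↦ ?_) hσ
      change c (τ v) = c v ↔ _
      rw [hc]
      by_cases hv : v ∈ special (a : ZMod (k + 2)) <;> simp [f, hv]
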